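/- Model. In each round $t=1,\dots,T$ of a repeated second-price auction a good has value $v_t\in[0,1]$ for the bidder and $m_t\in[0,1]$ is the highest competing bid. The bidder bids $b_t\in[0,1]$; he wins iff $b_t>m_t$ and then gets net utility $v_t-m_t$ (otherwise $0$). After each round he sees $m_t$, and he sees $v_t$ only if he won. A strategy chooses $b_t$ as a measurable function of the past bids, the past $m_s$, the values $v_s$ of the past rounds that were won, and possibly an independent random seed; it may depend on $T$. When the pairs $(v_t,m_t)$ are i.i.d. with law $\nu$, the pseudo-regret is $$\bar R_T(\nu)=\max_{b\in[0,1]}\sum_{t=1}^T\mathbb E\big[(v_t-m_t)\mathbf 1\{b>m_t\}\big]-\sum_{t=1}^T\mathbb E\big[(v_t-m_t)\mathbf 1\{b_t>m_t\}\big].$$ For $\alpha>0$ and $\varepsilon\in(0,1/4]$ let $\mu_\alpha=\mu_{\alpha,\varepsilon}$ be the following law on $[0,1]$: if $\alpha<1$, it has density proportional to $$\big(x-\tfrac12\big)^{\alpha-1}\mathbf 1\{x\in(\tfrac12,\tfrac12+2\varepsilon]\}+\big(x-\tfrac12-2\varepsilon\big)^{\alpha-1}\mathbf 1\{x\in(\tfrac12+2\varepsilon,1]\};$$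 if $\alpha\ge1$, it is the point mass at $\tfrac12+\varepsilon$. Let $\nu=\mathsf{Bern}(1/2)\otimes\mu_\alpha$ and $\nu'=\mathsf{Bern}(1/2+2\varepsilon)\otimes\mu_\alpha$. Theorem. Fix $\alpha>0$. (i) There is a constant $C_\alpha>0$ depending only on $\alpha$ such that for every $T\ge4$, with $\varepsilon=\frac12T^{-1/2}$, and for every strategy, $$\max\{\bar R_T(\nu),\bar R_T(\nu')\}\ge\begin{cases}C_\alpha T^{\frac{1-\alpha}2}&\text{if }\alpha<1,\\ C_\alpha\log T&\text{if }\alpha\ge1.\end{cases}$$ (ii) If $\alpha\ge1$, then also for every $\varepsilon\in(0,1/4)$ not depending on $T$ there is a constant $C_{\alpha,\varepsilon}>0$ such that $\max\{\bar R_T(\nu),\bar R_T(\nu')\}\ge C_{\alpha,\varepsilon}\log T$ for every $T\ge2$ and every strategy. (iii) The probability measure $\mu_{\alpha,\varepsilon}$, $\varepsilon\in(0,1/4]$, satisfies the margin condition with parameter $\alpha$ around both $v=1/2$ and $v=1/2+2\varepsilon$, i.e. $\mu_{\alpha,\varepsilon}((v,v+u])\le C\,u^\alpha$ for all $u>0$,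 where $C>0$ depends only on $\alpha$ if $\alpha<1$, and only on $\alpha$ and $\varepsilon$ if $\alpha\ge1$. -/

import Mathlib

open MeasureTheory ProbabilityTheory

noncomputable section

namespace VickreyBandit

/-- Net utility of bid `b` in a round `x = (v, m)`, where `v` is the value of the good and `m` the
highest competing bid: the good is won exactly when `b > m`, at price `m`. -/
def utility (b : ℝ) (x : ℝ × ℝ) : ℝ :=
  if x.2 < b then x.1 - x.2 else 0

/-- What the bidder records after bidding `b` in a round `x = (v, m)`: his own bid, the competing
bid, and the value of the good if he won. The entry `0` after a lost round carries no information: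
whether the round was won can be read off from the first two entries. -/
def feedback (b : ℝ) (x : ℝ × ℝ) : ℝ × ℝ × ℝ :=
  (b, x.2, if x.2 < b then x.1 else 0)

/-- A (possibly randomized) bidding strategy: a random seed, drawn once from `seedLaw`, and for each
round `t` (counted from `0`) a bid in `[0,1]` that is a measurable function of the seed and of the
feedback of the `t` previous rounds. Deterministic strategies are those with a one-point seed. -/
structure Strategy (Θ : Type*) [MeasurableSpace Θ] where
  seedLaw : Measure Θ
  isProbabilityMeasure_seedLaw : IsProbabilityMeasure seedLaw
  bid : (t : ℕ) → Θ → (Fin t → ℝ × ℝ × ℝ) → ℝ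
  measurable_bid : ∀ t : ℕ,
    Measurable fun q : Θ × (Fin t → ℝ × ℝ × ℝ) => bid t q.1 q.2
  bid_mem : ∀ (t : ℕ) (θ : Θ) (h : Fin t → ℝ × ℝ × ℝ), bid t θ h ∈ Set.Icc (0 : ℝ) 1

namespace Strategy

variable {Θ : Type*} [MeasurableSpace Θ]

/-- Feedback of the first `t` rounds when the strategy, with seed `θ`, is run on the sequence
`x` of pairs `(v, m)`. -/
def history (S : Strategy Θ) (θ : Θ) (x : ℕ → ℝ × ℝ) : (t : ℕ) → Fin t → ℝ × ℝ × ℝ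
  | 0 => Fin.elim0
  | t + 1 => Fin.snoc (α := fun _ => ℝ × ℝ × ℝ) (history S θ x t)
      (feedback (S.bid t θ (history S θ x t)) (x t))

/-- The bid that the strategy actually places in round `t`. -/
def playedBid (S : Strategy Θ) (θ : Θ) (x : ℕ → ℝ × ℝ) (t : ℕ) : ℝ :=
  S.bid t θ (S.history θ x t)

/-- Joint law of the seed and of the i.i.d. sequence of pairs `(v, m)` with common law `ν`; the
seed is independent of the sequence. -/
def jointLaw (S : Strategy Θ) (ν : Measure (ℝ × ℝ)) : Measure (Θ × (ℕ → ℝ × ℝ)) :=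
  S.seedLaw.prod (Measure.infinitePi fun _ : ℕ => ν)

/-- Pseudo-regret over `T` rounds, when the pairs `(v, m)` are i.i.d. with law `ν`. -/
def pseudoRegret (S : Strategy Θ) (ν : Measure (ℝ × ℝ)) (T : ℕ) : ℝ :=
  (⨆ b : Set.Icc (0 : ℝ) 1,
      ∑ t ∈ Finset.range T, ∫ ω, utility (b : ℝ) (ω.2 t) ∂(S.jointLaw ν)) -
    ∑ t ∈ Finset.range T,
      ∫ ω, utility (S.playedBid ω.1 ω.2 t) (ω.2 t) ∂(S.jointLaw ν)

end Strategy

/-- `μ` is a probability measure on `[0,1]` that satisfies the margin condition with parameter `α`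
and constant `C` around `v`. -/
structure MarginCondition (μ : Measure ℝ) (α C v : ℝ) : Prop where
  isProbabilityMeasure : IsProbabilityMeasure μ
  mem_unitInterval : ∀ᵐ x ∂μ, x ∈ Set.Icc (0 : ℝ) 1
  measure_Ioc_le : ∀ u : ℝ, 0 < u → μ (Set.Ioc v (v + u)) ≤ ENNReal.ofReal (C * u ^ α)

open Classical in
/-- The unnormalized density
`(x - 1/2)^(α-1) 1{x ∈ (1/2, 1/2+2ε]} + (x - 1/2 - 2ε)^(α-1) 1{x ∈ (1/2+2ε, 1]}`. -/
def bidDensity (α ε x : ℝ) : ℝ :=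
  (if x ∈ Set.Ioc (1 / 2) (1 / 2 + 2 * ε) then (x - 1 / 2) ^ (α - 1) else 0) +
    (if x ∈ Set.Ioc (1 / 2 + 2 * ε) 1 then (x - 1 / 2 - 2 * ε) ^ (α - 1) else 0)

open Classical in
/-- The law of the competing bids: for `α < 1` the distribution whose density is `bidDensity α ε`
normalized to total mass one, for `α ≥ 1` the point mass at `1/2 + ε`. -/
def bidLaw (α ε : ℝ) : Measure ℝ :=
  if α < 1 then
    (∫⁻ x, ENNReal.ofReal (bidDensity α ε x))⁻¹ •
      volume.withDensity fun x => ENNReal.ofReal (bidDensity α ε x)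
  else Measure.dirac (1 / 2 + ε)

/-- The instance `Bern(p) ⊗ μ_α`, for `p ∈ [0,1]` (a real `p` outside `[0,1]` is projected to it;
this never happens below). -/
def auctionLaw (α ε p : ℝ) : Measure (ℝ × ℝ) :=
  (bernoulliMeasure (1 : ℝ) 0 (Set.projIcc 0 1 zero_le_one p)).prod (bidLaw α ε)

/-- The larger of the two pseudo-regrets over `T` rounds, under `Bern(1/2) ⊗ μ_α` and under
`Bern(1/2 + 2ε) ⊗ μ_α`. -/
def worstRegret {Θ : Type*} [MeasurableSpace Θ] (S : Strategy Θ) (α ε : ℝ) (T : ℕ) : ℝ :=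
  max (S.pseudoRegret (auctionLaw α ε (1 / 2)) T)
    (S.pseudoRegret (auctionLaw α ε (1 / 2 + 2 * ε)) T)

end VickreyBandit

end

/-!
The regret is a sum of per-round losses: bidding the mean value of the good is optimal, bids above
`1/2 + ε` are costly under `Bern(1/2) ⊗ μ`, bids up to `1/2 + ε` are costly under
`Bern(1/2 + 2ε) ⊗ μ`, and the cost is at least `ε / 2` times `δ`, if `μ` gives at least the mass
`δ` to either of the intervals of length `ε / 2` next to `1/2 + ε`
(`sum_high_bids_le_pseudoRegret`, `sum_low_bids_le_pseudoRegret`). A strategy that does well on both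
instances therefore has to tell them apart. How far it can do so is bounded through the joint law
of seed and observed history (`Strategy.historyLaw`), by induction on the number of rounds, since
each new pair is independent of the history (`Strategy.lintegral_historyLaw_succ`).

For `ε` of order `T ^ (-1/2)` the instances are close even with full information: the density of
one round has second moment `1 + 16 ε ^ 2`, hence that of at most `T` rounds has second moment at
most `e ^ 4`, and by Cauchy–Schwarz a likely event under the second instance is likely under the
first (`Strategy.sq_lintegral_historyLaw_le`). So every round costs `ε δ` up to a constant
(`mul_le_worstRegret`). For `α < 1` the mass `δ` is of order `ε ^ α`, and the total is of order
`T ^ ((1 - α) / 2)`. For `α ≥ 1` one has `δ = 1`, and the total is of order `√T ≥ log T / 2`.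

For fixed `ε` and competing bid `1/2 + ε`, only bids above `1/2 + ε` are informative, and each of
them costs at most a factor `r = 1 - 4 ε` in the likelihood; so the law of the history under the
second instance is at least `r ^ N` times that under the first, with `N` the number of such bids
(`Strategy.lintegral_pow_bidCount_le`). If `N` has mean below a small multiple of `log T` under the
first instance, then bids up to `1/2 + ε` occur at least of order `√T` times in expectation
under the second (`Strategy.rpow_mul_le_sum_measureReal_bid`, `exists_mul_log_le_worstRegret`).

The margin condition and the estimates of `δ` are direct integrations of powers, the normalizing
constant lying between `1/2` and `2 / α`.
-/

open scoped ENNReal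

namespace VickreyBandit

/-! ### The law of the observed history -/

lemma measurable_update_prod {X : Type*} [MeasurableSpace X] (t : ℕ) :
    Measurable fun p : (ℕ → X) × X => Function.update p.1 t p.2 := by
  refine measurable_pi_lambda _ fun i => ?_
  by_cases h : i = t
  · subst h; simpa using measurable_snd
  · simp only [Function.update_of_ne h]
    fun_prop

/-- Resampling one coordinate of an i.i.d. sequence does not change its law. -/
lemma infinitePi_prod_map_update {X : Type*} [MeasurableSpace X] (ν : Measure X)
    [IsProbabilityMeasure ν] (t : ℕ) :
    ((Measure.infinitePi fun _ : ℕ => ν).prod ν).map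
      (fun p : (ℕ → X) × X => Function.update p.1 t p.2) = Measure.infinitePi fun _ : ℕ => ν := by
  have hm := measurable_update_prod (X := X) t
  refine Measure.eq_infinitePi _ fun s A hA => ?_
  rw [Measure.map_apply hm (MeasurableSet.pi s.countable_toSet fun i _ => hA i)]
  have hpre : (fun p : (ℕ → X) × X => Function.update p.1 t p.2) ⁻¹' Set.pi s A =
      Set.pi (s.erase t : Finset ℕ) A ×ˢ (if t ∈ s then A t else Set.univ) := by
    ext p
    simp only [Set.mem_preimage, Set.mem_pi, Set.mem_prod, Finset.mem_coe, Finset.mem_erase]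
    constructor
    · refine fun h => ⟨fun i hi => by simpa [Function.update_of_ne hi.1] using h i hi.2, ?_⟩
      split_ifs with ht
      · simpa using h t ht
      · trivial
    · rintro ⟨h1, h2⟩ i hi
      by_cases hit : i = t
      · subst hit; simpa [hi] using h2
      · simpa [Function.update_of_ne hit] using h1 i ⟨hit, hi⟩
  rw [hpre, Measure.prod_prod, Measure.infinitePi_pi _ fun i _ => hA i]
  split_ifs with ht
  · rw [Finset.prod_erase_mul s (fun i => ν (A i)) ht]
  · rw [Finset.erase_eq_of_notMem ht, measure_univ, mul_one]

lemma measurable_feedback :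
    Measurable fun q : ℝ × (ℝ × ℝ) => feedback q.1 q.2 := by
  refine measurable_fst.prodMk ((measurable_snd.comp measurable_snd).prodMk ?_)
  exact Measurable.ite (measurableSet_lt (by fun_prop) (by fun_prop)) (by fun_prop) (by fun_prop)

lemma measurable_utility : Measurable fun q : ℝ × (ℝ × ℝ) => utility q.1 q.2 :=
  Measurable.ite (measurableSet_lt (by fun_prop) (by fun_prop)) (by fun_prop) (by fun_prop)

lemma measurable_finSnoc {X : Type*} [MeasurableSpace X] (t : ℕ) :
    Measurable fun q : (Fin t → X) × X => (Fin.snoc (α := fun _ => X) q.1 q.2 : Fin (t + 1) → X) := by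
  refine measurable_pi_lambda _ fun i => ?_
  induction i using Fin.lastCases with
  | last => simpa using measurable_snd
  | cast i => simp only [Fin.snoc_castSucc]; fun_prop

namespace Strategy

variable {Θ : Type*} [MeasurableSpace Θ] (S : Strategy Θ) (ν : Measure (ℝ × ℝ))

/-- The seed together with the history after round `t`, when the round `y` is played on top of the
seed and history `q` before round `t`. -/
noncomputable def step (t : ℕ) (q : Θ × (Fin t → ℝ × ℝ × ℝ)) (y : ℝ × ℝ) :
    Θ × (Fin (t + 1) → ℝ × ℝ × ℝ) :=
  (q.1, Fin.snoc (α := fun _ => ℝ × ℝ × ℝ) q.2 (feedback (S.bid t q.1 q.2) y))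

lemma measurable_step (t : ℕ) :
    Measurable fun r : (Θ × (Fin t → ℝ × ℝ × ℝ)) × (ℝ × ℝ) => S.step t r.1 r.2 := by
  have hb : Measurable fun r : (Θ × (Fin t → ℝ × ℝ × ℝ)) × (ℝ × ℝ) => S.bid t r.1.1 r.1.2 :=
    (S.measurable_bid t).comp measurable_fst
  exact (measurable_fst.comp measurable_fst).prodMk ((measurable_finSnoc t).comp
    ((measurable_snd.comp measurable_fst).prodMk
      (measurable_feedback.comp (hb.prodMk measurable_snd))))

lemma history_congr (θ : Θ) {x x' : ℕ → ℝ × ℝ} :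
    ∀ t : ℕ, (∀ s < t, x s = x' s) → S.history θ x t = S.history θ x' t
  | 0, _ => rfl
  | t + 1, h => by
    have ih := history_congr θ t fun s hs => h s (hs.trans t.lt_succ_self)
    simp only [history, ih, h t t.lt_succ_self]

lemma measurable_history (t : ℕ) :
    Measurable fun ω : Θ × (ℕ → ℝ × ℝ) => (ω.1, S.history ω.1 ω.2 t) := by
  induction t with
  | zero => exact measurable_fst.prodMk (measurable_pi_lambda _ fun i => i.elim0)
  | succ t ih =>
    exact (S.measurable_step t).comp
      (ih.prodMk ((measurable_pi_apply t).comp measurable_snd))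

lemma measurable_history_prod (t : ℕ) :
    Measurable fun ω : Θ × (ℕ → ℝ × ℝ) => ((ω.1, S.history ω.1 ω.2 t), ω.2 t) :=
  (S.measurable_history t).prodMk ((measurable_pi_apply t).comp measurable_snd)

/-- The joint law of the seed and of the feedback of the first `t` rounds. -/
noncomputable def historyLaw (t : ℕ) : Measure (Θ × (Fin t → ℝ × ℝ × ℝ)) :=
  (S.jointLaw ν).map fun ω => (ω.1, S.history ω.1 ω.2 t)

instance : IsProbabilityMeasure S.seedLaw := S.isProbabilityMeasure_seedLaw

variable [IsProbabilityMeasure ν]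

instance : IsProbabilityMeasure (S.jointLaw ν) := by
  unfold jointLaw; infer_instance

instance (t : ℕ) : IsProbabilityMeasure (S.historyLaw ν t) :=
  Measure.isProbabilityMeasure_map (S.measurable_history t).aemeasurable

/-- The pair drawn in round `t` is independent of the seed and of the history before round `t`. -/
lemma map_history_prod_eq (t : ℕ) :
    (S.jointLaw ν).map (fun ω => ((ω.1, S.history ω.1 ω.2 t), ω.2 t)) =
      (S.historyLaw ν t).prod ν := by
  have hm := measurable_update_prod (X := ℝ × ℝ) t
  have hm' : Measurable (fun p : (Θ × (ℕ → ℝ × ℝ)) × (ℝ × ℝ) =>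
      (p.1.1, Function.update p.1.2 t p.2)) :=
    (measurable_fst.comp measurable_fst).prodMk
      (hm.comp ((measurable_snd.comp measurable_fst).prodMk measurable_snd))
  have hr : S.jointLaw ν = ((S.jointLaw ν).prod ν).map
      (fun p : (Θ × (ℕ → ℝ × ℝ)) × (ℝ × ℝ) => (p.1.1, Function.update p.1.2 t p.2)) := by
    have h1 : (fun p : (Θ × (ℕ → ℝ × ℝ)) × (ℝ × ℝ) => (p.1.1, Function.update p.1.2 t p.2)) =
        Prod.map id (fun p : (ℕ → ℝ × ℝ) × (ℝ × ℝ) => Function.update p.1 t p.2) ∘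
          MeasurableEquiv.prodAssoc := rfl
    rw [h1, ← Measure.map_map (measurable_id.prodMap hm) MeasurableEquiv.prodAssoc.measurable]
    unfold jointLaw
    rw [(measurePreserving_prodAssoc _ _ _).map_eq, ← Measure.map_prod_map _ _ measurable_id hm,
      infinitePi_prod_map_update, Measure.map_id]
  have hp : (S.historyLaw ν t).prod ν = ((S.jointLaw ν).prod ν).map
      (Prod.map (fun ω => (ω.1, S.history ω.1 ω.2 t)) id) := by
    rw [← Measure.map_prod_map _ _ (S.measurable_history t) measurable_id, Measure.map_id,
      historyLaw]
  conv_lhs => rw [hr]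
  rw [Measure.map_map (S.measurable_history_prod t) hm', hp]
  congr 1
  funext p
  simp only [Function.comp_apply, Function.update_self, Prod.map, id_eq]
  rw [S.history_congr p.1.1 t fun s hs => Function.update_of_ne hs.ne _ _]

lemma historyLaw_succ (t : ℕ) :
    S.historyLaw ν (t + 1) =
      ((S.historyLaw ν t).prod ν).map fun r => S.step t r.1 r.2 := by
  rw [← map_history_prod_eq, Measure.map_map (S.measurable_step t) (S.measurable_history_prod t)]
  rfl

lemma lintegral_historyLaw_succ (t : ℕ) {f : Θ × (Fin (t + 1) → ℝ × ℝ × ℝ) → ℝ≥0∞}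
    (hf : Measurable f) :
    ∫⁻ q, f q ∂(S.historyLaw ν (t + 1)) =
      ∫⁻ q, ∫⁻ y, f (S.step t q y) ∂ν ∂(S.historyLaw ν t) := by
  rw [historyLaw_succ, lintegral_map hf (S.measurable_step t)]
  exact lintegral_prod _ (hf.comp (S.measurable_step t)).aemeasurable

/-- Before the first round nothing has been observed, so the history law does not depend on the
instance. -/
lemma historyLaw_zero (ν' : Measure (ℝ × ℝ)) [IsProbabilityMeasure ν'] :
    S.historyLaw ν 0 = S.historyLaw ν' 0 := by
  have h (ρ : Measure (ℝ × ℝ)) [IsProbabilityMeasure ρ] : S.historyLaw ρ 0 =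
      S.seedLaw.map fun θ => (θ, (Fin.elim0 : Fin 0 → ℝ × ℝ × ℝ)) := by
    have hm : Measurable fun θ : Θ => (θ, (Fin.elim0 : Fin 0 → ℝ × ℝ × ℝ)) :=
      measurable_id.prodMk measurable_const
    have h2 : S.seedLaw = (S.jointLaw ρ).map Prod.fst := by
      simp [jointLaw, Measure.map_fst_prod]
    rw [h2, Measure.map_map hm measurable_fst]
    rfl
  rw [h, h]

/-! ### Regret as a sum of per-round losses -/

/-- The pseudo-regret dominates any per-round loss of bids in a set `B`, weighted with the
probability that the strategy bids in `B`. -/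
lemma sum_le_pseudoRegret (hν : ∀ᵐ y ∂ν, |y.1 - y.2| ≤ 1) {b₀ κ : ℝ} (hb₀ : b₀ ∈ Set.Icc (0 : ℝ) 1)
    {B : Set ℝ} (hB : MeasurableSet B)
    (hgap : ∀ b ∈ Set.Icc (0 : ℝ) 1,
      B.indicator (fun _ => κ) b ≤ ∫ y, utility b₀ y ∂ν - ∫ y, utility b y ∂ν) (T : ℕ) :
    κ * ∑ t ∈ Finset.range T, (S.historyLaw ν t).real {q | S.bid t q.1 q.2 ∈ B} ≤
      S.pseudoRegret ν T := by
  have hu (b : ℝ) : ∀ᵐ y ∂ν, ‖utility b y‖ ≤ 1 := by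
    filter_upwards [hν] with y hy
    unfold utility
    split_ifs <;> simp [hy]
  have hmu (b : ℝ) : Measurable (utility b) := measurable_utility.comp measurable_prodMk_left
  have hle (b : ℝ) : ∫ y, utility b y ∂ν ≤ 1 := by
    refine (le_abs_self _).trans ?_
    simpa using norm_integral_le_of_norm_le_const (hu b)
  have hconst (b : ℝ) (t : ℕ) :
      ∫ ω, utility b (ω.2 t) ∂(S.jointLaw ν) = ∫ y, utility b y ∂ν := by
    have h1 : (S.jointLaw ν).map (fun ω => ω.2 t) = ν := by
      have h2 : (fun ω : Θ × (ℕ → ℝ × ℝ) => ω.2 t) = Function.eval t ∘ Prod.snd := rfl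
      rw [h2, ← Measure.map_map (measurable_pi_apply t) measurable_snd, jointLaw,
        Measure.map_snd_prod, measure_univ, one_smul]
      exact Measure.infinitePi_map_eval _ t
    conv_rhs => rw [← h1]
    exact (integral_map ((measurable_pi_apply t).comp measurable_snd).aemeasurable
      (hmu b).aestronglyMeasurable).symm
  have hplay (t : ℕ) : ∫ ω, utility (S.playedBid ω.1 ω.2 t) (ω.2 t) ∂(S.jointLaw ν) =
      ∫ q, ∫ y, utility (S.bid t q.1 q.2) y ∂ν ∂(S.historyLaw ν t) ∧
      Integrable (fun q => ∫ y, utility (S.bid t q.1 q.2) y ∂ν) (S.historyLaw ν t) := by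
    have hm : Measurable fun r : (Θ × (Fin t → ℝ × ℝ × ℝ)) × (ℝ × ℝ) =>
        utility (S.bid t r.1.1 r.1.2) r.2 :=
      measurable_utility.comp (((S.measurable_bid t).comp measurable_fst).prodMk measurable_snd)
    have hi : Integrable (fun r : (Θ × (Fin t → ℝ × ℝ × ℝ)) × (ℝ × ℝ) =>
        utility (S.bid t r.1.1 r.1.2) r.2) ((S.historyLaw ν t).prod ν) := by
      refine Integrable.of_bound hm.aestronglyMeasurable 1 ?_
      refine (Measure.ae_prod_iff_ae_ae
        (measurableSet_le hm.norm measurable_const)).2 (Filter.Eventually.of_forall fun q =>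
        hu (S.bid t q.1 q.2))
    refine ⟨?_, hi.integral_prod_left⟩
    rw [← integral_prod _ hi, ← map_history_prod_eq, integral_map
      (S.measurable_history_prod t).aemeasurable hm.aestronglyMeasurable]
    rfl
  have hsup : ∑ t ∈ Finset.range T, ∫ y, utility b₀ y ∂ν ≤
      ⨆ b : Set.Icc (0 : ℝ) 1,
        ∑ t ∈ Finset.range T, ∫ ω, utility (b : ℝ) (ω.2 t) ∂(S.jointLaw ν) := by
    refine le_ciSup_of_le ⟨∑ t ∈ Finset.range T, 1, ?_⟩ (⟨b₀, hb₀⟩ : Set.Icc (0 : ℝ) 1) ?_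
    · rintro _ ⟨b, rfl⟩
      exact Finset.sum_le_sum fun t _ => (hconst b t).trans_le (hle b)
    · exact Finset.sum_le_sum fun t _ => (hconst b₀ t).ge
  refine le_trans ?_ (sub_le_sub_right hsup _)
  rw [← Finset.sum_sub_distrib, Finset.mul_sum]
  refine Finset.sum_le_sum fun t _ => ?_
  obtain ⟨h1, h2⟩ := hplay t
  have hset : MeasurableSet {q : Θ × (Fin t → ℝ × ℝ × ℝ) | S.bid t q.1 q.2 ∈ B} :=
    S.measurable_bid t hB
  rw [h1, mul_comm, ← smul_eq_mul, ← integral_indicator_const κ hset]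
  have h3 : ∫ y, utility b₀ y ∂ν = ∫ _q, ∫ y, utility b₀ y ∂ν ∂(S.historyLaw ν t) := by simp
  rw [h3, ← integral_sub (integrable_const _) h2]
  refine integral_mono ((integrable_const κ).indicator hset) ((integrable_const _).sub h2) ?_
  exact fun q => hgap _ (S.bid_mem t q.1 q.2)

end Strategy

/-! ### Change of measure -/

/-- The Cauchy–Schwarz inequality for squares of nonnegative functions. -/
lemma sq_lintegral_mul_le {X : Type*} [MeasurableSpace X] (μ : Measure X) {f g : X → ℝ≥0∞}
    (hf : AEMeasurable f μ) (hg : AEMeasurable g μ) :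
    (∫⁻ x, f x * g x ∂μ) ^ 2 ≤ (∫⁻ x, f x ^ 2 ∂μ) * ∫⁻ x, g x ^ 2 ∂μ := by
  have h := ENNReal.lintegral_mul_le_Lp_mul_Lq μ Real.HolderConjugate.two_two hf hg
  simp only [Pi.mul_apply, ENNReal.rpow_ofNat] at h
  refine (pow_le_pow_left' h 2).trans_eq ?_
  rw [mul_pow, ← ENNReal.rpow_mul_natCast, ← ENNReal.rpow_mul_natCast]
  norm_num

/-- The number of past rounds in which the recorded bid lies in `D`. -/
noncomputable def bidCount (D : Set ℝ) {t : ℕ} (h : Fin t → ℝ × ℝ × ℝ) : ℕ :=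
  ∑ i, D.indicator (fun _ => 1) (h i).1

lemma measurable_bidCount {D : Set ℝ} (hD : MeasurableSet D) (t : ℕ) :
    Measurable fun h : Fin t → ℝ × ℝ × ℝ => bidCount D h :=
  Finset.measurable_sum _ fun i _ => (measurable_const.indicator hD).comp
    (measurable_fst.comp (measurable_pi_apply i))

lemma bidCount_snoc (D : Set ℝ) {t : ℕ} (h : Fin t → ℝ × ℝ × ℝ) (z : ℝ × ℝ × ℝ) :
    bidCount D (Fin.snoc (α := fun _ => ℝ × ℝ × ℝ) h z) =
      bidCount D h + D.indicator (fun _ => 1) z.1 := by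
  simp [bidCount, Fin.sum_univ_castSucc]

namespace Strategy

variable {Θ : Type*} [MeasurableSpace Θ] (S : Strategy Θ) {ν ν' : Measure (ℝ × ℝ)}
  [IsProbabilityMeasure ν] [IsProbabilityMeasure ν']

/-- If the density of `ν'` with respect to `ν` has second moment at most `K`, then the law of the
history after `t` rounds has, with respect to its law under `ν`, a density of second moment at most
`K ^ t`; this is expressed by duality against test functions. -/
lemma sq_lintegral_historyLaw_le {ℓ : ℝ × ℝ → ℝ≥0∞} (hℓ : Measurable ℓ)
    (hν' : ν' = ν.withDensity ℓ) {K : ℝ≥0∞} (hK : ∫⁻ y, ℓ y ^ 2 ∂ν ≤ K) (t : ℕ)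
    {f : Θ × (Fin t → ℝ × ℝ × ℝ) → ℝ≥0∞} (hf : Measurable f) :
    (∫⁻ q, f q ∂(S.historyLaw ν' t)) ^ 2 ≤ K ^ t * ∫⁻ q, f q ^ 2 ∂(S.historyLaw ν t) := by
  induction t with
  | zero =>
    rw [S.historyLaw_zero ν' ν, pow_zero, one_mul]
    simpa using sq_lintegral_mul_le (S.historyLaw ν 0) hf.aemeasurable
      (aemeasurable_const (b := (1 : ℝ≥0∞)))
  | succ t ih =>
    have hfs := hf.comp (S.measurable_step t)
    rw [lintegral_historyLaw_succ _ _ _ hf, lintegral_historyLaw_succ _ _ _ (hf.pow_const 2)]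
    refine (ih hfs.lintegral_prod_right').trans ?_
    have hc : K * ∫⁻ q, ∫⁻ y, f (S.step t q y) ^ 2 ∂ν ∂(S.historyLaw ν t) =
        ∫⁻ q, K * ∫⁻ y, f (S.step t q y) ^ 2 ∂ν ∂(S.historyLaw ν t) :=
      (lintegral_const_mul _ (hfs.pow_const 2).lintegral_prod_right').symm
    rw [pow_succ, mul_assoc, hc]
    gcongr with q
    have hq : Measurable fun y => f (S.step t q y) := hfs.comp measurable_prodMk_left
    simp only [Function.comp_apply]
    rw [hν', lintegral_withDensity_eq_lintegral_mul _ hℓ hq]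
    refine (sq_lintegral_mul_le ν hℓ.aemeasurable hq.aemeasurable).trans ?_
    gcongr

/-- If a round with a bid in `D` costs at most a factor `r` when passing from `ν` to `ν'`, and the
feedback of a round with any other bid costs nothing, then the law of the history under `ν'` has,
with respect to its law under `ν`, a density of at least `r` to the number of bids in `D`. -/
lemma lintegral_pow_bidCount_le {D : Set ℝ} (hD : MeasurableSet D) {r : ℝ≥0∞}
    (hstep : ∀ (b : ℝ) (F : ℝ × ℝ × ℝ → ℝ≥0∞), Measurable F →
      r ^ D.indicator (fun _ => 1) b * ∫⁻ y, F (feedback b y) ∂ν ≤ ∫⁻ y, F (feedback b y) ∂ν')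
    (t : ℕ) {f : Θ × (Fin t → ℝ × ℝ × ℝ) → ℝ≥0∞} (hf : Measurable f) :
    ∫⁻ q, r ^ bidCount D q.2 * f q ∂(S.historyLaw ν t) ≤ ∫⁻ q, f q ∂(S.historyLaw ν' t) := by
  have hpow (s : ℕ) : Measurable fun q : Θ × (Fin s → ℝ × ℝ × ℝ) => r ^ bidCount D q.2 :=
    (measurable_of_countable fun n : ℕ => r ^ n).comp
      ((measurable_bidCount hD s).comp measurable_snd)
  induction t with
  | zero => simp [S.historyLaw_zero ν' ν, bidCount]
  | succ t ih =>
    have hfs := hf.comp (S.measurable_step t)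
    have hmul : Measurable fun q => r ^ bidCount D q.2 * f q := (hpow (t + 1)).mul hf
    rw [lintegral_historyLaw_succ _ _ _ hf, lintegral_historyLaw_succ _ _ _ hmul]
    refine le_trans ?_ (ih hfs.lintegral_prod_right')
    gcongr with q
    have hq : Measurable fun y => f (S.step t q y) := hfs.comp measurable_prodMk_left
    have h1 (y : ℝ × ℝ) : r ^ bidCount D (S.step t q y).2 =
        r ^ bidCount D q.2 * r ^ D.indicator (fun _ => 1) (S.bid t q.1 q.2) := by
      rw [step, bidCount_snoc, pow_add, feedback]
    simp only [h1, mul_assoc]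
    have hqF : Measurable fun z : ℝ × ℝ × ℝ =>
        f (q.1, Fin.snoc (α := fun _ => ℝ × ℝ × ℝ) q.2 z) :=
      hf.comp (measurable_const.prodMk
        ((measurable_finSnoc t).comp (measurable_const.prodMk measurable_id)))
    rw [lintegral_const_mul _ (hq.const_mul _), lintegral_const_mul _ hq]
    gcongr
    exact hstep (S.bid t q.1 q.2) _ hqF

/-- Two instances that are hard to tell apart by full information: a set of bids that is likely in
round `t` under `ν'` is also likely under `ν`. -/
lemma sq_measureReal_bid_le {ℓ : ℝ × ℝ → ℝ≥0∞} (hℓ : Measurable ℓ)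
    (hν' : ν' = ν.withDensity ℓ) {K : ℝ} (hK0 : 0 ≤ K)
    (hK : ∫⁻ y, ℓ y ^ 2 ∂ν ≤ ENNReal.ofReal K) {B : Set ℝ}
    (hB : MeasurableSet B) (t : ℕ) :
    (S.historyLaw ν' t).real {q | S.bid t q.1 q.2 ∈ B} ^ 2 ≤
      K ^ t * (S.historyLaw ν t).real {q | S.bid t q.1 q.2 ∈ B} := by
  have hset : MeasurableSet {q : Θ × (Fin t → ℝ × ℝ × ℝ) | S.bid t q.1 q.2 ∈ B} :=
    S.measurable_bid t hB
  have h := S.sq_lintegral_historyLaw_le hℓ hν' hK t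
    ((measurable_const (a := (1 : ℝ≥0∞))).indicator hset)
  have hsq (A : Set (Θ × (Fin t → ℝ × ℝ × ℝ))) (q : Θ × (Fin t → ℝ × ℝ × ℝ)) :
      A.indicator (fun _ => (1 : ℝ≥0∞)) q ^ 2 = A.indicator (fun _ => 1) q := by
    by_cases hq : q ∈ A <;> simp [hq]
  simp only [hsq, lintegral_indicator_const hset, one_mul] at h
  have h' := ENNReal.toReal_mono (by finiteness) h
  simpa [Measure.real, ENNReal.toReal_mul, ENNReal.toReal_pow, hK0] using h'

/-- If bids outside `D` are uninformative and bids in `D` are rare under `ν`, then bids outside `D`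
are frequent under `ν'`. -/
lemma rpow_mul_le_sum_measureReal_bid {D : Set ℝ} (hD : MeasurableSet D) {r : ℝ} (hr0 : 0 < r)
    (hr1 : r ≤ 1)
    (hstep : ∀ (b : ℝ) (F : ℝ × ℝ × ℝ → ℝ≥0∞), Measurable F →
      ENNReal.ofReal r ^ D.indicator (fun _ => 1) b * ∫⁻ y, F (feedback b y) ∂ν ≤
        ∫⁻ y, F (feedback b y) ∂ν')
    {T : ℕ} {k : ℝ} (hk0 : 0 < k) (hkT : k ≤ T) :
    r ^ k * (T - k) *
        (1 - (∑ t ∈ Finset.range T, (S.historyLaw ν t).real {q | S.bid t q.1 q.2 ∈ D}) / k) ≤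
      ∑ t ∈ Finset.range T, (S.historyLaw ν' t).real {q | S.bid t q.1 q.2 ∈ Dᶜ} := by
  have hset (A : Set ℝ) (hA : MeasurableSet A) (t : ℕ) :
      MeasurableSet {q : Θ × (Fin t → ℝ × ℝ × ℝ) | S.bid t q.1 q.2 ∈ A} :=
    S.measurable_bid t hA
  have hcount (t : ℕ) : Measurable fun ω : Θ × (ℕ → ℝ × ℝ) => bidCount D (S.history ω.1 ω.2 t) :=
    (measurable_bidCount hD t).comp (measurable_snd.comp (S.measurable_history t))
  have hplay (t : ℕ) : Measurable fun ω : Θ × (ℕ → ℝ × ℝ) => S.playedBid ω.1 ω.2 t :=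
    (S.measurable_bid t).comp (S.measurable_history t)
  have hsucc (t : ℕ) (ω : Θ × (ℕ → ℝ × ℝ)) : bidCount D (S.history ω.1 ω.2 (t + 1)) =
      bidCount D (S.history ω.1 ω.2 t) + D.indicator (fun _ => 1) (S.playedBid ω.1 ω.2 t) := by
    rw [history, bidCount_snoc]; rfl
  -- Both sides are compared with integrals against the single law `S.jointLaw ν`.
  have hreal (t : ℕ) : (S.historyLaw ν t).real {q | S.bid t q.1 q.2 ∈ D} =
      ∫ ω, D.indicator (fun _ => (1 : ℝ)) (S.playedBid ω.1 ω.2 t) ∂(S.jointLaw ν) := by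
    rw [historyLaw, map_measureReal_apply (S.measurable_history t) (hset D hD t)]
    exact (integral_indicator_one ((hplay t) hD)).symm
  have hint (t : ℕ) : Integrable
      (fun ω => D.indicator (fun _ => (1 : ℝ)) (S.playedBid ω.1 ω.2 t)) (S.jointLaw ν) :=
    (integrable_const (1 : ℝ)).indicator ((hplay t) hD)
  have hmeas' (t : ℕ) : Measurable fun ω : Θ × (ℕ → ℝ × ℝ) => r ^ bidCount D (S.history ω.1 ω.2 t) *
      Dᶜ.indicator (fun _ => (1 : ℝ)) (S.playedBid ω.1 ω.2 t) :=
    ((measurable_of_countable fun n : ℕ => r ^ n).comp (hcount t)).mul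
      ((measurable_const.indicator hD.compl).comp (hplay t))
  have hnn (t : ℕ) (ω : Θ × (ℕ → ℝ × ℝ)) : 0 ≤ r ^ bidCount D (S.history ω.1 ω.2 t) *
      Dᶜ.indicator (fun _ => (1 : ℝ)) (S.playedBid ω.1 ω.2 t) :=
    mul_nonneg (by positivity) (Set.indicator_nonneg (fun _ _ => zero_le_one) _)
  have hint' (t : ℕ) : Integrable (fun ω => r ^ bidCount D (S.history ω.1 ω.2 t) *
      Dᶜ.indicator (fun _ => (1 : ℝ)) (S.playedBid ω.1 ω.2 t)) (S.jointLaw ν) := by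
    refine Integrable.of_bound (hmeas' t).aestronglyMeasurable 1 (.of_forall fun ω => ?_)
    rw [Real.norm_of_nonneg (hnn t ω)]
    exact mul_le_one₀ (pow_le_one₀ hr0.le hr1) (Set.indicator_nonneg (fun _ _ => zero_le_one) _)
      (Set.indicator_le_self' (fun _ _ => zero_le_one) _)
  have hlow (t : ℕ) : ∫ ω, r ^ bidCount D (S.history ω.1 ω.2 t) *
      Dᶜ.indicator (fun _ => (1 : ℝ)) (S.playedBid ω.1 ω.2 t) ∂(S.jointLaw ν) ≤
      (S.historyLaw ν' t).real {q | S.bid t q.1 q.2 ∈ Dᶜ} := by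
    rw [integral_eq_lintegral_of_nonneg_ae (.of_forall (hnn t)) (hmeas' t).aestronglyMeasurable]
    refine ENNReal.toReal_mono (measure_ne_top _ _) ?_
    have h := S.lintegral_pow_bidCount_le hD hstep t
      ((measurable_one (α := ℝ≥0∞)).indicator (hset Dᶜ hD.compl t))
    have hm : Measurable fun q : Θ × (Fin t → ℝ × ℝ × ℝ) => ENNReal.ofReal r ^ bidCount D q.2 *
        {q | S.bid t q.1 q.2 ∈ Dᶜ}.indicator 1 q :=
      ((measurable_of_countable fun n : ℕ => ENNReal.ofReal r ^ n).comp
        ((measurable_bidCount hD t).comp measurable_snd)).mul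
        (measurable_one.indicator (hset Dᶜ hD.compl t))
    rw [lintegral_indicator_one (hset Dᶜ hD.compl t), historyLaw,
      lintegral_map hm (S.measurable_history t)] at h
    refine le_trans (lintegral_mono fun ω => ?_) h
    rw [ENNReal.ofReal_mul (by positivity), ENNReal.ofReal_pow hr0.le]
    gcongr
    by_cases hω : S.playedBid ω.1 ω.2 t ∈ D
    · simp [hω]
    · have : S.bid t ω.1 (S.history ω.1 ω.2 t) ∉ D := hω
      simp [hω, this]
  -- Along every trajectory, `r ^ N * (T - N)` is at most the sum of the integrands on the right,
  -- where `N` is the number of bids in `D`.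
  have hsum (n : ℕ) (ω : Θ × (ℕ → ℝ × ℝ)) :
      r ^ bidCount D (S.history ω.1 ω.2 n) * (n - bidCount D (S.history ω.1 ω.2 n)) ≤
        ∑ t ∈ Finset.range n, r ^ bidCount D (S.history ω.1 ω.2 t) *
          Dᶜ.indicator (fun _ => (1 : ℝ)) (S.playedBid ω.1 ω.2 t) ∧
      (bidCount D (S.history ω.1 ω.2 n) : ℝ) = ∑ t ∈ Finset.range n,
        D.indicator (fun _ => (1 : ℝ)) (S.playedBid ω.1 ω.2 t) ∧
      bidCount D (S.history ω.1 ω.2 n) ≤ n := by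
    induction n with
    | zero => simp [bidCount]
    | succ n ih =>
      obtain ⟨ih1, ih2, ih3⟩ := ih
      rw [Finset.sum_range_succ, Finset.sum_range_succ, ← ih2, hsucc]
      have ih4 : (bidCount D (S.history ω.1 ω.2 n) : ℝ) ≤ n := by exact_mod_cast ih3
      by_cases hω : S.playedBid ω.1 ω.2 n ∈ D
      · simp only [hω, Set.indicator_of_mem, Set.mem_compl_iff, not_true, not_false_iff,
          Set.indicator_of_notMem]
        push_cast
        refine ⟨?_, rfl, by omega⟩
        rw [mul_zero, add_zero, add_sub_add_right_eq_sub]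
        refine le_trans (mul_le_mul_of_nonneg_right ?_ (by linarith)) ih1
        exact pow_le_pow_of_le_one hr0.le hr1 (Nat.le_succ _)
      · simp only [hω, Set.indicator_of_mem, Set.mem_compl_iff, not_false_iff,
          Set.indicator_of_notMem]
        push_cast
        refine ⟨?_, by simp, by omega⟩
        simp only [add_zero]
        linarith
  have hpt (n : ℕ) (hn : n ≤ T) : r ^ k * (T - k) * (1 - n / k) ≤ r ^ n * (T - n) := by
    have hnT : (n : ℝ) ≤ T := by exact_mod_cast hn
    rcases le_total (n : ℝ) k with h | h
    · have h1 : r ^ k ≤ r ^ n := by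
        rw [← Real.rpow_natCast]; exact Real.rpow_le_rpow_of_exponent_ge hr0 hr1 h
      have h2 : (1 : ℝ) - n / k ≤ 1 := by linarith [div_nonneg n.cast_nonneg hk0.le]
      have h3 : 0 ≤ r ^ k * (T - k) := mul_nonneg (by positivity) (by linarith)
      calc r ^ k * (T - k) * (1 - n / k) ≤ r ^ k * (T - k) := mul_le_of_le_one_right h3 h2
        _ ≤ r ^ n * (T - n) := by gcongr
    · have h2 : (1 : ℝ) - n / k ≤ 0 := by
        rw [sub_nonpos, le_div_iff₀ hk0]; linarith
      exact (mul_nonpos_of_nonneg_of_nonpos (mul_nonneg (by positivity) (by linarith)) h2).trans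
        (mul_nonneg (by positivity) (by linarith))
  have hinta : Integrable (fun ω => ∑ t ∈ Finset.range T,
      D.indicator (fun _ => (1 : ℝ)) (S.playedBid ω.1 ω.2 t)) (S.jointLaw ν) :=
    integrable_finsetSum _ fun t _ => hint t
  calc _ = ∫ ω, r ^ k * (T - k) * (1 - (∑ t ∈ Finset.range T,
          D.indicator (fun _ => (1 : ℝ)) (S.playedBid ω.1 ω.2 t)) / k) ∂(S.jointLaw ν) := by
        rw [integral_const_mul, integral_sub (integrable_const _) (hinta.div_const k),
          integral_div, integral_finsetSum _ fun t _ => hint t]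
        simp [hreal]
    _ ≤ ∫ ω, ∑ t ∈ Finset.range T, r ^ bidCount D (S.history ω.1 ω.2 t) *
          Dᶜ.indicator (fun _ => (1 : ℝ)) (S.playedBid ω.1 ω.2 t) ∂(S.jointLaw ν) := by
        refine integral_mono (((integrable_const _).sub (hinta.div_const k)).const_mul _)
          (integrable_finsetSum _ fun t _ => hint' t) fun ω => ?_
        obtain ⟨h1, h2, h3⟩ := hsum T ω
        simp only
        rw [← h2]
        exact (hpt _ h3).trans h1
    _ = ∑ t ∈ Finset.range T, ∫ ω, r ^ bidCount D (S.history ω.1 ω.2 t) *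
          Dᶜ.indicator (fun _ => (1 : ℝ)) (S.playedBid ω.1 ω.2 t) ∂(S.jointLaw ν) :=
        integral_finsetSum _ fun t _ => hint' t
    _ ≤ _ := Finset.sum_le_sum fun t _ => hlow t

end Strategy
/-! ### The two instances -/

section auctionLaw

variable {α ε p : ℝ} [IsProbabilityMeasure (bidLaw α ε)]

instance : IsProbabilityMeasure (auctionLaw α ε p) := by
  unfold auctionLaw; infer_instance

lemma auctionLaw_eq (hp : p ∈ Set.Icc (0 : ℝ) 1) :
    auctionLaw α ε p = ENNReal.ofReal p • (bidLaw α ε).map (Prod.mk 1) +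
      ENNReal.ofReal (1 - p) • (bidLaw α ε).map (Prod.mk 0) := by
  have h1 : bernoulliMeasure (1 : ℝ) 0 (Set.projIcc 0 1 zero_le_one p) =
      ENNReal.ofReal p • Measure.dirac 1 + ENNReal.ofReal (1 - p) • Measure.dirac 0 := by
    rw [bernoulliMeasure_def, Set.projIcc_of_mem _ hp]
    congr 1
    · congr 1
      exact NNReal.eq (Real.coe_toNNReal _ hp.1).symm
    · congr 1
      exact NNReal.eq (Real.coe_toNNReal _ (sub_nonneg.2 hp.2)).symm
  rw [auctionLaw, h1, Measure.add_prod, Measure.prod_smul_left, Measure.prod_smul_left,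
    Measure.dirac_prod, Measure.dirac_prod]

lemma lintegral_auctionLaw (hp : p ∈ Set.Icc (0 : ℝ) 1) {f : ℝ × ℝ → ℝ≥0∞} (hf : Measurable f) :
    ∫⁻ y, f y ∂(auctionLaw α ε p) = ENNReal.ofReal p * ∫⁻ x, f (1, x) ∂(bidLaw α ε) +
      ENNReal.ofReal (1 - p) * ∫⁻ x, f (0, x) ∂(bidLaw α ε) := by
  rw [auctionLaw_eq hp, lintegral_add_measure, lintegral_smul_measure, lintegral_smul_measure,
    lintegral_map hf measurable_prodMk_left, lintegral_map hf measurable_prodMk_left]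
  rfl

lemma abs_sub_le_one_ae (hμ : ∀ᵐ x ∂(bidLaw α ε), x ∈ Set.Icc (0 : ℝ) 1)
    (hp : p ∈ Set.Icc (0 : ℝ) 1) : ∀ᵐ y ∂(auctionLaw α ε p), |y.1 - y.2| ≤ 1 := by
  have hm : MeasurableSet {y : ℝ × ℝ | |y.1 - y.2| ≤ 1} :=
    measurableSet_le (by fun_prop) (by fun_prop)
  rw [auctionLaw_eq hp]
  refine ae_add_measure_iff.2 ⟨Measure.ae_smul_measure ?_ _, Measure.ae_smul_measure ?_ _⟩
  all_goals
    refine (ae_map_iff measurable_prodMk_left.aemeasurable hm).2 ?_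
    filter_upwards [hμ] with x hx
    rw [abs_le]
    constructor <;> linarith [hx.1, hx.2]

lemma integrable_netUtility (hμ : ∀ᵐ x ∂(bidLaw α ε), x ∈ Set.Icc (0 : ℝ) 1)
    (hp : p ∈ Set.Icc (0 : ℝ) 1) (b : ℝ) :
    Integrable (fun x => if x < b then p - x else 0) (bidLaw α ε) := by
  refine Integrable.of_bound (Measurable.aestronglyMeasurable
    (Measurable.ite measurableSet_Iio (by fun_prop) (by fun_prop))) 1 ?_
  filter_upwards [hμ] with x hx
  split_ifs
  · rw [Real.norm_eq_abs, abs_le]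
    constructor <;> linarith [hx.1, hx.2, hp.1, hp.2]
  · simp

/-- Only the mean `p` of the value of the good matters for the expected utility of a fixed bid. -/
lemma integral_utility (hμ : ∀ᵐ x ∂(bidLaw α ε), x ∈ Set.Icc (0 : ℝ) 1)
    (hp : p ∈ Set.Icc (0 : ℝ) 1) (b : ℝ) :
    ∫ y, utility b y ∂(auctionLaw α ε p) =
      ∫ x, (if x < b then p - x else 0) ∂(bidLaw α ε) := by
  have hmu : Measurable (utility b) := measurable_utility.comp measurable_prodMk_left
  have hi (v : ℝ) (hv : v ∈ Set.Icc (0 : ℝ) 1) :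
      Integrable (utility b) ((bidLaw α ε).map (Prod.mk v)) := by
    rw [integrable_map_measure hmu.aestronglyMeasurable measurable_prodMk_left.aemeasurable]
    exact integrable_netUtility hμ hv b
  have h1 := hi 1 (by simp)
  have h0 := hi 0 (by simp)
  have h1' : Integrable (fun x => utility b (1, x)) (bidLaw α ε) :=
    integrable_netUtility hμ ⟨zero_le_one, le_rfl⟩ b
  have h0' : Integrable (fun x => utility b (0, x)) (bidLaw α ε) :=
    integrable_netUtility hμ ⟨le_rfl, zero_le_one⟩ b
  rw [auctionLaw_eq hp, integral_add_measure (h1.smul_measure ENNReal.ofReal_ne_top)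
    (h0.smul_measure ENNReal.ofReal_ne_top), integral_smul_measure, integral_smul_measure,
    integral_map measurable_prodMk_left.aemeasurable hmu.aestronglyMeasurable,
    integral_map measurable_prodMk_left.aemeasurable hmu.aestronglyMeasurable,
    ENNReal.toReal_ofReal hp.1, ENNReal.toReal_ofReal (sub_nonneg.2 hp.2), smul_eq_mul,
    smul_eq_mul, ← integral_const_mul, ← integral_const_mul,
    ← integral_add (h1'.const_mul _) (h0'.const_mul _)]
  congr 1
  funext x
  unfold utility
  split_ifs <;> ring

/-- Bidding the mean value `p` is optimal, also conditionally on the competing bid; so the expected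
loss of another bid `b` is at least its expected loss on any event of competing bids. -/
lemma mul_measureReal_le_utility_gap (hμ : ∀ᵐ x ∂(bidLaw α ε), x ∈ Set.Icc (0 : ℝ) 1)
    (hp : p ∈ Set.Icc (0 : ℝ) 1) {b c : ℝ} {I : Set ℝ} (hI : MeasurableSet I)
    (hgap : ∀ x ∈ I, c ≤ (if x < p then p - x else 0) - (if x < b then p - x else 0)) :
    c * (bidLaw α ε).real I ≤
      ∫ y, utility p y ∂(auctionLaw α ε p) - ∫ y, utility b y ∂(auctionLaw α ε p) := by
  rw [integral_utility hμ hp, integral_utility hμ hp, ← integral_sub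
    (integrable_netUtility hμ hp p) (integrable_netUtility hμ hp b), mul_comm, ← smul_eq_mul,
    ← integral_indicator_const c hI]
  refine integral_mono ((integrable_const c).indicator hI)
    ((integrable_netUtility hμ hp p).sub (integrable_netUtility hμ hp b)) fun x => ?_
  by_cases hx : x ∈ I
  · simpa [hx] using hgap x hx
  · simp only [hx, not_false_iff, Set.indicator_of_notMem]
    split_ifs <;> linarith

/-- The two instances differ by a likelihood ratio that depends on the value of the good only. -/
lemma auctionLaw_withDensity (hε0 : 0 ≤ ε) (hε : ε ≤ 1 / 4) :
    auctionLaw α ε (1 / 2 + 2 * ε) = (auctionLaw α ε (1 / 2)).withDensity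
      fun y => ENNReal.ofReal (1 + 4 * ε * (2 * y.1 - 1)) := by
  have hℓ : Measurable fun y : ℝ × ℝ => ENNReal.ofReal (1 + 4 * ε * (2 * y.1 - 1)) := by fun_prop
  refine Measure.ext_of_lintegral _ fun f hf => ?_
  rw [lintegral_withDensity_eq_lintegral_mul _ hℓ hf,
    lintegral_auctionLaw ⟨by linarith, by linarith⟩ hf,
    lintegral_auctionLaw ⟨by norm_num, by norm_num⟩ (hℓ.mul hf)]
  simp only [Pi.mul_apply]
  have hfv (v : ℝ) : Measurable fun x => f (v, x) := hf.comp measurable_prodMk_left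
  rw [lintegral_const_mul _ (hfv 1), lintegral_const_mul _ (hfv 0), ← mul_assoc, ← mul_assoc,
    ← ENNReal.ofReal_mul (by norm_num), ← ENNReal.ofReal_mul (by norm_num)]
  congr 3 <;> ring

lemma lintegral_likelihoodRatio_sq (hε0 : 0 ≤ ε) (hε : ε ≤ 1 / 4) :
    ∫⁻ y, ENNReal.ofReal (1 + 4 * ε * (2 * y.1 - 1)) ^ 2 ∂(auctionLaw α ε (1 / 2)) =
      ENNReal.ofReal (1 + 16 * ε ^ 2) := by
  rw [lintegral_auctionLaw ⟨by norm_num, by norm_num⟩ (by fun_prop)]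
  simp only [lintegral_const, measure_univ, mul_one]
  rw [← ENNReal.ofReal_pow (by linarith), ← ENNReal.ofReal_pow (by linarith),
    ← ENNReal.ofReal_mul (by norm_num), ← ENNReal.ofReal_mul (by norm_num),
    ← ENNReal.ofReal_add (by positivity) (by norm_num; positivity)]
  congr 1
  ring

end auctionLaw

/-! ### Lower bounds on the regret -/

section regret

variable {Θ : Type*} [MeasurableSpace Θ] (S : Strategy Θ) {α ε δ : ℝ}
  [IsProbabilityMeasure (bidLaw α ε)]

/-- Bids above `1/2 + ε` are costly if the mean value of the good is `1/2`. -/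
lemma sum_high_bids_le_pseudoRegret (hμ : ∀ᵐ x ∂(bidLaw α ε), x ∈ Set.Icc (0 : ℝ) 1)
    (hε0 : 0 ≤ ε) (hδ : δ ≤ (bidLaw α ε).real (Set.Icc (1 / 2 + ε / 2) (1 / 2 + ε))) (T : ℕ) :
    ε / 2 * δ * ∑ t ∈ Finset.range T,
        (S.historyLaw (auctionLaw α ε (1 / 2)) t).real {q | S.bid t q.1 q.2 ∈ Set.Ioi (1 / 2 + ε)} ≤
      S.pseudoRegret (auctionLaw α ε (1 / 2)) T := by
  have hp : (1 / 2 : ℝ) ∈ Set.Icc (0 : ℝ) 1 := ⟨by norm_num, by norm_num⟩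
  refine S.sum_le_pseudoRegret _ (abs_sub_le_one_ae hμ hp) hp measurableSet_Ioi (fun b _ => ?_) T
  by_cases hb : b ∈ Set.Ioi (1 / 2 + ε)
  · rw [Set.indicator_of_mem hb]
    refine (mul_le_mul_of_nonneg_left hδ (by positivity)).trans
      (mul_measureReal_le_utility_gap hμ hp measurableSet_Icc fun x hx => ?_)
    rw [if_neg (by linarith [hx.1]), if_pos (hx.2.trans_lt hb)]
    linarith [hx.1]
  · rw [Set.indicator_of_notMem hb]
    simpa using mul_measureReal_le_utility_gap (b := b) (c := 0) hμ hp MeasurableSet.empty (by simp)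

/-- Bids up to `1/2 + ε` are costly if the mean value of the good is `1/2 + 2 * ε`. -/
lemma sum_low_bids_le_pseudoRegret (hμ : ∀ᵐ x ∂(bidLaw α ε), x ∈ Set.Icc (0 : ℝ) 1)
    (hε0 : 0 < ε) (hε : ε ≤ 1 / 4)
    (hδ : δ ≤ (bidLaw α ε).real (Set.Icc (1 / 2 + ε) (1 / 2 + 3 * ε / 2))) (T : ℕ) :
    ε / 2 * δ * ∑ t ∈ Finset.range T, (S.historyLaw (auctionLaw α ε (1 / 2 + 2 * ε)) t).real
        {q | S.bid t q.1 q.2 ∈ (Set.Ioi (1 / 2 + ε))ᶜ} ≤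
      S.pseudoRegret (auctionLaw α ε (1 / 2 + 2 * ε)) T := by
  have hp : 1 / 2 + 2 * ε ∈ Set.Icc (0 : ℝ) 1 := ⟨by linarith, by linarith⟩
  refine S.sum_le_pseudoRegret _ (abs_sub_le_one_ae hμ hp) hp measurableSet_Ioi.compl
    (fun b _ => ?_) T
  by_cases hb : b ∈ (Set.Ioi (1 / 2 + ε))ᶜ
  · rw [Set.indicator_of_mem hb]
    have hb' : b ≤ 1 / 2 + ε := not_lt.1 hb
    refine (mul_le_mul_of_nonneg_left hδ (by positivity)).trans
      (mul_measureReal_le_utility_gap hμ hp measurableSet_Icc fun x hx => ?_)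
    rw [if_pos (by linarith [hx.2]), if_neg (by linarith [hx.1])]
    linarith [hx.2]
  · rw [Set.indicator_of_notMem hb]
    simpa using mul_measureReal_le_utility_gap (b := b) (c := 0) hμ hp MeasurableSet.empty (by simp)

/-- As long as `ε ^ 2 * T` is bounded the two instances cannot be told apart, so that in every round
the strategy errs with positive probability on one of them. -/
lemma mul_le_worstRegret (hμ : ∀ᵐ x ∂(bidLaw α ε), x ∈ Set.Icc (0 : ℝ) 1)
    (hε0 : 0 < ε) (hε : ε ≤ 1 / 4) (hδ0 : 0 ≤ δ)
    (hδ : δ ≤ (bidLaw α ε).real (Set.Icc (1 / 2 + ε / 2) (1 / 2 + ε)))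
    (hδ' : δ ≤ (bidLaw α ε).real (Set.Icc (1 / 2 + ε) (1 / 2 + 3 * ε / 2)))
    {T : ℕ} (hT : 4 * (ε ^ 2 * T) ≤ 1) :
    3 / 16 * Real.exp (-4) * (T * ε * δ) ≤ worstRegret S α ε T := by
  have h1 := sum_high_bids_le_pseudoRegret S hμ hε0.le hδ T
  have h2 := sum_low_bids_le_pseudoRegret S hμ hε0 hε hδ' T
  have key : ∀ t ∈ Finset.range T, 3 / 4 * Real.exp (-4) ≤
      (S.historyLaw (auctionLaw α ε (1 / 2)) t).real {q | S.bid t q.1 q.2 ∈ Set.Ioi (1 / 2 + ε)} +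
      (S.historyLaw (auctionLaw α ε (1 / 2 + 2 * ε)) t).real
        {q | S.bid t q.1 q.2 ∈ (Set.Ioi (1 / 2 + ε))ᶜ} := by
    intro t ht
    have hset : MeasurableSet {q : Θ × (Fin t → ℝ × ℝ × ℝ) |
        S.bid t q.1 q.2 ∈ Set.Ioi (1 / 2 + ε)} := S.measurable_bid t measurableSet_Ioi
    have hsq := S.sq_measureReal_bid_le (by fun_prop) (auctionLaw_withDensity (α := α) hε0.le hε)
      (by positivity) (lintegral_likelihoodRatio_sq hε0.le hε).le
      (measurableSet_Ioi (a := 1 / 2 + ε)) t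
    have hcompl := probReal_compl_eq_one_sub
      (μ := S.historyLaw (auctionLaw α ε (1 / 2 + 2 * ε)) t) hset
    have hK : (1 + 16 * ε ^ 2) ^ t ≤ Real.exp 4 := by
      have htT : (t : ℝ) ≤ T := by exact_mod_cast (Finset.mem_range.1 ht).le
      calc (1 + 16 * ε ^ 2) ^ t ≤ Real.exp (16 * ε ^ 2) ^ t := by
            gcongr; linarith [Real.add_one_le_exp (16 * ε ^ 2)]
        _ = Real.exp (t * (16 * ε ^ 2)) := (Real.exp_nat_mul _ _).symm
        _ ≤ Real.exp 4 := by
            refine Real.exp_le_exp.2 ?_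
            nlinarith [sq_nonneg ε]
    have hcompl' : (S.historyLaw (auctionLaw α ε (1 / 2 + 2 * ε)) t).real
        {q | S.bid t q.1 q.2 ∈ (Set.Ioi (1 / 2 + ε))ᶜ} = _ := hcompl
    rw [hcompl']
    set y := (S.historyLaw (auctionLaw α ε (1 / 2)) t).real
      {q | S.bid t q.1 q.2 ∈ Set.Ioi (1 / 2 + ε)}
    set x := (S.historyLaw (auctionLaw α ε (1 / 2 + 2 * ε)) t).real
      {q | S.bid t q.1 q.2 ∈ Set.Ioi (1 / 2 + ε)}
    have hy : 0 ≤ y := measureReal_nonneg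
    have hx : x ≤ 1 := measureReal_le_one
    have hE : Real.exp (-4) * Real.exp 4 = 1 := by rw [← Real.exp_add]; simp
    have hE1 : Real.exp (-4) ≤ 1 := Real.exp_le_one_iff.2 (by norm_num)
    have hxy : Real.exp (-4) * x ^ 2 ≤ y := by
      calc Real.exp (-4) * x ^ 2 ≤ Real.exp (-4) * (Real.exp 4 * y) := by
            gcongr; exact hsq.trans (by gcongr)
        _ = y := by rw [← mul_assoc, hE, one_mul]
    -- The minimum of `x ^ 2 + (1 - x)` is `3 / 4`.
    nlinarith [Real.exp_pos (-4), mul_nonneg (Real.exp_pos (-4)).le (sq_nonneg (x - 1 / 2)),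
      mul_nonneg (sub_nonneg.2 hE1) (sub_nonneg.2 hx)]
  have hsum := Finset.sum_le_sum key
  rw [Finset.sum_add_distrib, Finset.sum_const, Finset.card_range, nsmul_eq_mul] at hsum
  have h3 := mul_le_mul_of_nonneg_left hsum (by positivity : 0 ≤ ε / 2 * δ)
  rw [mul_add] at h3
  have h4 := le_max_left (S.pseudoRegret (auctionLaw α ε (1 / 2)) T)
    (S.pseudoRegret (auctionLaw α ε (1 / 2 + 2 * ε)) T)
  have h5 := le_max_right (S.pseudoRegret (auctionLaw α ε (1 / 2)) T)
    (S.pseudoRegret (auctionLaw α ε (1 / 2 + 2 * ε)) T)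
  unfold worstRegret
  linarith

end regret

/-- If the competing bid is always `1/2 + ε`, the strategy learns about the good only by bidding
more than `1/2 + ε`. Under mean value `1/2` this is a loss, but doing so logarithmically often is
necessary: otherwise, under mean value `1/2 + 2 * ε`, a run with few such bids is too likely. -/
lemma exists_mul_log_le_worstRegret {α ε : ℝ} (hα : 1 ≤ α) (hε0 : 0 < ε) (hε : ε < 1 / 4) :
    ∃ c : ℝ, 0 < c ∧ ∀ T : ℕ, 2 ≤ T → ∀ (Θ : Type*) [MeasurableSpace Θ] (S : Strategy Θ),
      c * Real.log T ≤ worstRegret S α ε T := by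
  have hlaw : bidLaw α ε = Measure.dirac (1 / 2 + ε) := by rw [bidLaw, if_neg hα.not_gt]
  have hprob : IsProbabilityMeasure (bidLaw α ε) := by rw [hlaw]; infer_instance
  have hμ : ∀ᵐ x ∂(bidLaw α ε), x ∈ Set.Icc (0 : ℝ) 1 := by
    rw [hlaw]
    exact (ae_dirac_iff measurableSet_Icc).2 ⟨by linarith, by linarith⟩
  set r : ℝ := 1 - 4 * ε with hr
  have hr0 : 0 < r := by linarith
  have hr1 : r < 1 := by linarith
  have hlogr : 0 < -Real.log r := by linarith [Real.log_neg hr0 hr1]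
  set c₀ : ℝ := min (1 / 2) (1 / (2 * -Real.log r))
  have hc0 : 0 < c₀ := lt_min (by norm_num) (by positivity)
  have hc1 : c₀ ≤ 1 / 2 := min_le_left _ _
  have hc2 : -Real.log r * c₀ ≤ 1 / 2 := by
    calc -Real.log r * c₀ ≤ -Real.log r * (1 / (2 * -Real.log r)) := by
          gcongr; exact min_le_right _ _
      _ = 1 / 2 := by rw [mul_one_div, mul_comm 2, div_mul_cancel_left₀ hlogr.ne', one_div]
  refine ⟨ε / 2 * (c₀ / 4), by positivity, fun T hT Θ _ S => ?_⟩
  have hT2 : (2 : ℝ) ≤ T := by exact_mod_cast hT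
  have hlog : 0 < Real.log T := Real.log_pos (by linarith)
  have hlogT : Real.log T ≤ T := by
    linarith [Real.log_le_sub_one_of_pos (by linarith : (0 : ℝ) < T)]
  have h1 := sum_high_bids_le_pseudoRegret S hμ hε0.le (δ := 1) (by
    rw [hlaw, measureReal_def, Measure.dirac_apply_of_mem (by constructor <;> linarith)]; simp) T
  have h2 := sum_low_bids_le_pseudoRegret S hμ hε0 hε.le (δ := 1) (by
    rw [hlaw, measureReal_def, Measure.dirac_apply_of_mem (by constructor <;> linarith)]; simp) T
  have hstep : ∀ (b : ℝ) (F : ℝ × ℝ × ℝ → ℝ≥0∞), Measurable F →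
      ENNReal.ofReal r ^ (Set.Ioi (1 / 2 + ε)).indicator (fun _ => 1) b *
          ∫⁻ y, F (feedback b y) ∂(auctionLaw α ε (1 / 2)) ≤
        ∫⁻ y, F (feedback b y) ∂(auctionLaw α ε (1 / 2 + 2 * ε)) := by
    intro b F hF
    have hm : Measurable fun y => F (feedback b y) :=
      hF.comp (measurable_feedback.comp measurable_prodMk_left)
    rw [lintegral_auctionLaw ⟨by norm_num, by norm_num⟩ hm,
      lintegral_auctionLaw ⟨by linarith, by linarith⟩ hm]
    by_cases hb : b ∈ Set.Ioi (1 / 2 + ε)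
    · rw [Set.indicator_of_mem hb, pow_one, mul_add, ← mul_assoc, ← mul_assoc,
        ← ENNReal.ofReal_mul hr0.le, ← ENNReal.ofReal_mul hr0.le]
      gcongr <;> linarith
    · have hb' : ¬ 1 / 2 + ε < b := hb
      have hmv (v : ℝ) : Measurable fun x => F (feedback b (v, x)) :=
        hm.comp measurable_prodMk_left
      rw [Set.indicator_of_notMem hb, pow_zero, one_mul, hlaw, lintegral_dirac' _ (hmv 1),
        lintegral_dirac' _ (hmv 0)]
      simp only [feedback, hb', if_false]
      rw [← add_mul, ← add_mul, ← ENNReal.ofReal_add (by norm_num) (by norm_num),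
        ← ENNReal.ofReal_add (by linarith) (by linarith), add_sub_cancel, add_sub_cancel]
  -- The horizon allows for `k` informative rounds; `c₀` is so small that `r ^ k ≥ T ^ (-1/2)`.
  set k : ℝ := c₀ * Real.log T with hk
  have hk0 : 0 < k := by positivity
  have hkT : k ≤ T / 2 := by nlinarith
  have h3 := S.rpow_mul_le_sum_measureReal_bid (measurableSet_Ioi (a := 1 / 2 + ε)) hr0 hr1.le
    hstep hk0 (by linarith : k ≤ T)
  set A := ∑ t ∈ Finset.range T, (S.historyLaw (auctionLaw α ε (1 / 2)) t).real
    {q | S.bid t q.1 q.2 ∈ Set.Ioi (1 / 2 + ε)}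
  rw [mul_one] at h1 h2
  rcases le_total (k / 2) A with hA | hA
  · refine le_trans ?_ (le_max_left _ _)
    refine le_trans ?_ h1
    rw [mul_assoc]
    gcongr
    refine le_trans ?_ hA
    rw [hk]
    nlinarith
  · refine le_trans ?_ (le_max_right _ _)
    refine le_trans ?_ h2
    rw [mul_assoc]
    gcongr
    refine le_trans ?_ h3
    have hrk : (T : ℝ) ^ (-(1 / 2) : ℝ) ≤ r ^ k := by
      rw [Real.rpow_def_of_pos (by linarith), Real.rpow_def_of_pos hr0]
      refine Real.exp_le_exp.2 ?_
      rw [hk]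
      nlinarith
    have hAk : 1 / 2 ≤ 1 - A / k := by
      rw [le_sub_comm, div_le_iff₀ hk0]; linarith
    have hsqrt : Real.log T ≤ 2 * (T : ℝ) ^ (1 / 2 : ℝ) := by
      have := Real.log_le_rpow_div (x := T) (by linarith) (ε := 1 / 2) (by norm_num)
      linarith
    have hTT : (T : ℝ) ^ (-(1 / 2) : ℝ) * T = (T : ℝ) ^ (1 / 2 : ℝ) := by
      rw [← Real.rpow_add_one (by linarith)]; norm_num
    calc c₀ / 4 * Real.log T ≤ (T : ℝ) ^ (1 / 2 : ℝ) / 4 := by nlinarith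
      _ = (T : ℝ) ^ (-(1 / 2) : ℝ) * (T / 2) * (1 / 2) := by rw [← hTT]; ring
      _ ≤ r ^ k * (T - k) * (1 - A / k) := by
          gcongr
          · exact mul_nonneg (by positivity) (by linarith)
          · linarith

/-! ### The law of the competing bids -/

lemma lintegral_Ioc_rpow_sub {α u : ℝ} (hα : 0 < α) (hu : 0 ≤ u) (a : ℝ) :
    ∫⁻ x in Set.Ioc a (a + u), ENNReal.ofReal ((x - a) ^ (α - 1)) =
      ENNReal.ofReal (u ^ α / α) := by
  have hi : IntervalIntegrable (fun x => (x - a) ^ (α - 1)) volume a (a + u) := by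
    have := (intervalIntegral.intervalIntegrable_rpow' (a := 0) (b := u)
      (by linarith : -1 < α - 1)).comp_sub_right a
    simpa [add_comm] using this
  have hle : a ≤ a + u := by linarith
  rw [← ofReal_integral_eq_lintegral_ofReal
    ((intervalIntegrable_iff_integrableOn_Ioc_of_le hle).1 hi),
    ← intervalIntegral.integral_of_le hle,
    intervalIntegral.integral_comp_sub_right (fun x => x ^ (α - 1)) a,
    integral_rpow (Or.inl (by linarith))]
  · simp [Real.zero_rpow hα.ne']
  · filter_upwards [ae_restrict_mem measurableSet_Ioc] with x hx
    exact Real.rpow_nonneg (by linarith [hx.1]) _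

/-- One of the two summands of `bidDensity`, integrated over an interval that starts to the left or
to the right of the support of that summand. -/
lemma setLIntegral_indicator_rpow_sub_le {α u a c v : ℝ} (hα : 0 < α) (hu : 0 ≤ u)
    (hv : v ≤ a ∨ c ≤ v) :
    ∫⁻ x in Set.Ioc v (v + u),
        (Set.Ioc a c).indicator (fun x => ENNReal.ofReal ((x - a) ^ (α - 1))) x ≤
      ENNReal.ofReal (u ^ α / α) := by
  rw [← lintegral_Ioc_rpow_sub hα hu a, setLIntegral_indicator measurableSet_Ioc]
  refine lintegral_mono_set fun x ⟨⟨h1, h2⟩, h3, h4⟩ => ⟨h1, ?_⟩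
  rcases hv with hv | hv <;> linarith

lemma ofReal_bidDensity (α ε x : ℝ) : ENNReal.ofReal (bidDensity α ε x) =
    (Set.Ioc (1 / 2) (1 / 2 + 2 * ε)).indicator
        (fun x => ENNReal.ofReal ((x - 1 / 2) ^ (α - 1))) x +
      (Set.Ioc (1 / 2 + 2 * ε) 1).indicator
        (fun x => ENNReal.ofReal ((x - (1 / 2 + 2 * ε)) ^ (α - 1))) x := by
  rw [bidDensity, ENNReal.ofReal_add]
  · simp only [Set.indicator_apply]
    congr 1
    · split_ifs <;> simp
    · split_ifs
      · rw [sub_sub]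
      · simp
  · split_ifs with h
    · exact Real.rpow_nonneg (by linarith [h.1]) _
    · exact le_rfl
  · split_ifs with h
    · exact Real.rpow_nonneg (by linarith [h.1]) _
    · exact le_rfl

lemma measurable_ofReal_rpow_sub (α a : ℝ) :
    Measurable fun x : ℝ => ENNReal.ofReal ((x - a) ^ (α - 1)) := by fun_prop

lemma setLIntegral_bidDensity_le {α ε u v : ℝ} (hα : 0 < α) (hε : 0 ≤ ε) (hu : 0 ≤ u)
    (hv : v = 1 / 2 ∨ v = 1 / 2 + 2 * ε) :
    ∫⁻ x in Set.Ioc v (v + u), ENNReal.ofReal (bidDensity α ε x) ≤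
      ENNReal.ofReal (2 / α * u ^ α) := by
  have h0 : 0 ≤ u ^ α / α := div_nonneg (Real.rpow_nonneg hu _) hα.le
  simp only [ofReal_bidDensity]
  rw [lintegral_add_left ((measurable_ofReal_rpow_sub α _).indicator measurableSet_Ioc),
    show 2 / α * u ^ α = u ^ α / α + u ^ α / α by ring, ENNReal.ofReal_add h0 h0]
  refine add_le_add (setLIntegral_indicator_rpow_sub_le hα hu ?_)
    (setLIntegral_indicator_rpow_sub_le hα hu ?_)
  · rcases hv with rfl | rfl
    exacts [Or.inl le_rfl, Or.inr le_rfl]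
  · rcases hv with rfl | rfl
    exacts [Or.inl (by linarith), Or.inl le_rfl]

lemma bidDensity_eq_zero {α ε x : ℝ} (hε0 : 0 ≤ ε) (hε : ε ≤ 1 / 4)
    (hx : x ∉ Set.Ioc (1 / 2) (1 / 2 + 1 / 2)) : bidDensity α ε x = 0 := by
  have h1 : x ∉ Set.Ioc (1 / 2) (1 / 2 + 2 * ε) := fun h => hx ⟨h.1, by linarith [h.2]⟩
  have h2 : x ∉ Set.Ioc (1 / 2 + 2 * ε) 1 := fun h =>
    hx ⟨by linarith [h.1], by linarith [h.2]⟩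
  rw [bidDensity, if_neg h1, if_neg h2, add_zero]

lemma lintegral_bidDensity_le {α ε : ℝ} (hα : 0 < α) (hε0 : 0 ≤ ε) (hε : ε ≤ 1 / 4) :
    ∫⁻ x, ENNReal.ofReal (bidDensity α ε x) ≤ ENNReal.ofReal (2 / α) := by
  have hs : Function.support (fun x => ENNReal.ofReal (bidDensity α ε x)) ⊆
      Set.Ioc (1 / 2) (1 / 2 + 1 / 2) := by
    intro x hx
    by_contra h
    exact hx (by simp [bidDensity_eq_zero hε0 hε h])
  rw [← setLIntegral_eq_of_support_subset hs]
  refine (setLIntegral_bidDensity_le hα hε0 (by norm_num) (Or.inl rfl)).trans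
    (ENNReal.ofReal_le_ofReal ?_)
  exact mul_le_of_le_one_right (by positivity) (Real.rpow_le_one (by norm_num) (by norm_num) hα.le)

/-- For `α < 1` the density is at least `1` on the whole of `(1/2, 1]`. -/
lemma half_le_lintegral_bidDensity {α ε : ℝ} (hα : α < 1) (hε0 : 0 ≤ ε) :
    ENNReal.ofReal (1 / 2) ≤ ∫⁻ x, ENNReal.ofReal (bidDensity α ε x) := by
  have h1 : ENNReal.ofReal (1 / 2) = ∫⁻ _ in Set.Ioc (1 / 2 : ℝ) 1, 1 := by
    rw [setLIntegral_one, Real.volume_Ioc]; norm_num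
  rw [h1, ← lintegral_indicator measurableSet_Ioc]
  refine lintegral_mono fun x => ?_
  by_cases hx : x ∈ Set.Ioc (1 / 2 : ℝ) 1
  · have hpow (y : ℝ) (h0 : 0 < y) (h1 : y ≤ 1) : 1 ≤ ENNReal.ofReal (y ^ (α - 1)) :=
      ENNReal.one_le_ofReal.2 (Real.one_le_rpow_of_pos_of_le_one_of_nonpos h0 h1 (by linarith))
    rw [Set.indicator_of_mem hx, ofReal_bidDensity]
    rcases le_or_gt x (1 / 2 + 2 * ε) with h | h
    · refine le_add_right ?_
      rw [Set.indicator_of_mem (show x ∈ Set.Ioc _ _ from ⟨hx.1, h⟩)]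
      exact hpow _ (by linarith [hx.1]) (by linarith [hx.2])
    · refine le_add_left ?_
      rw [Set.indicator_of_mem (show x ∈ Set.Ioc _ _ from ⟨h, hx.2⟩)]
      exact hpow _ (by linarith) (by linarith [hx.2])
  · rw [Set.indicator_of_notMem hx]
    exact zero_le

lemma bidLaw_apply {α ε : ℝ} (hα : α < 1) {s : Set ℝ} (hs : MeasurableSet s) :
    bidLaw α ε s = (∫⁻ x, ENNReal.ofReal (bidDensity α ε x))⁻¹ *
      ∫⁻ x in s, ENNReal.ofReal (bidDensity α ε x) := by
  rw [bidLaw, if_pos hα, Measure.smul_apply, withDensity_apply _ hs, smul_eq_mul]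

lemma isProbabilityMeasure_bidLaw {α ε : ℝ} (hα0 : 0 < α) (hα : α < 1) (hε0 : 0 ≤ ε)
    (hε : ε ≤ 1 / 4) : IsProbabilityMeasure (bidLaw α ε) := by
  constructor
  rw [bidLaw_apply hα MeasurableSet.univ, setLIntegral_univ]
  refine ENNReal.inv_mul_cancel (fun h => ?_)
    ((lintegral_bidDensity_le hα0 hε0 hε).trans_lt ENNReal.ofReal_lt_top).ne
  have := half_le_lintegral_bidDensity hα hε0
  rw [h] at this
  norm_num at this

lemma bidLaw_mem_Icc {α ε : ℝ} (hα0 : 0 < α) (hα : α < 1) (hε0 : 0 ≤ ε) (hε : ε ≤ 1 / 4) :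
    ∀ᵐ x ∂(bidLaw α ε), x ∈ Set.Icc (0 : ℝ) 1 := by
  rw [ae_iff]
  change bidLaw α ε (Set.Icc (0 : ℝ) 1)ᶜ = 0
  rw [bidLaw_apply hα measurableSet_Icc.compl]
  have h0 : ∫⁻ x in (Set.Icc (0 : ℝ) 1)ᶜ, ENNReal.ofReal (bidDensity α ε x) = 0 := by
    refine (setLIntegral_congr_fun measurableSet_Icc.compl fun x hx => ?_).trans lintegral_zero
    have hx' : x ∉ Set.Ioc (1 / 2 : ℝ) (1 / 2 + 1 / 2) := fun h =>
      hx ⟨by linarith [h.1], by linarith [h.2]⟩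
    simp [bidDensity_eq_zero hε0 hε hx']
  rw [h0, mul_zero]

lemma bidLaw_Ioc_le {α ε : ℝ} (hα0 : 0 < α) (hα : α < 1) (hε0 : 0 ≤ ε) {u v : ℝ} (hu : 0 ≤ u)
    (hv : v = 1 / 2 ∨ v = 1 / 2 + 2 * ε) :
    bidLaw α ε (Set.Ioc v (v + u)) ≤ ENNReal.ofReal (4 / α * u ^ α) := by
  have hZ : (∫⁻ x, ENNReal.ofReal (bidDensity α ε x))⁻¹ ≤ ENNReal.ofReal 2 := by
    refine (ENNReal.inv_le_inv.2 (half_le_lintegral_bidDensity hα hε0)).trans_eq ?_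
    rw [← ENNReal.ofReal_inv_of_pos (by norm_num)]
    norm_num
  rw [bidLaw_apply hα measurableSet_Ioc]
  refine (mul_le_mul' hZ (setLIntegral_bidDensity_le hα0 hε0 hu hv)).trans_eq ?_
  rw [← ENNReal.ofReal_mul (by norm_num)]
  congr 1
  ring

/-- On `(1/2, 1/2 + 2ε]` the density before normalization is at least `(2ε)^(α-1)`. -/
lemma mul_rpow_le_bidLaw_Icc {α ε : ℝ} (hα0 : 0 < α) (hα : α < 1) (hε0 : 0 ≤ ε)
    (hε : ε ≤ 1 / 4) {s : ℝ} (hs0 : 1 / 2 < s) (hs : s + ε / 2 ≤ 1 / 2 + 2 * ε) :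
    α / 8 * (2 * ε) ^ α ≤ (bidLaw α ε).real (Set.Icc s (s + ε / 2)) := by
  have := isProbabilityMeasure_bidLaw hα0 hα hε0 hε
  have hε1 : 0 < ε := by linarith
  rw [measureReal_def, ← ENNReal.ofReal_le_iff_le_toReal (measure_ne_top _ _),
    bidLaw_apply hα measurableSet_Icc]
  have hZ : ENNReal.ofReal (α / 2) ≤ (∫⁻ x, ENNReal.ofReal (bidDensity α ε x))⁻¹ := by
    refine le_trans (Eq.le ?_) (ENNReal.inv_le_inv.2 (lintegral_bidDensity_le hα0 hε0 hε))
    rw [← ENNReal.ofReal_inv_of_pos (by positivity), inv_div]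
  have hd : ENNReal.ofReal ((2 * ε) ^ (α - 1) * (ε / 2)) ≤
      ∫⁻ x in Set.Icc s (s + ε / 2), ENNReal.ofReal (bidDensity α ε x) := by
    calc ENNReal.ofReal ((2 * ε) ^ (α - 1) * (ε / 2)) =
          ∫⁻ _ in Set.Icc s (s + ε / 2), ENNReal.ofReal ((2 * ε) ^ (α - 1)) := by
          rw [setLIntegral_const, Real.volume_Icc, add_sub_cancel_left,
            ENNReal.ofReal_mul (by positivity)]
      _ ≤ _ := by
          refine setLIntegral_mono' measurableSet_Icc fun x hx => ?_
          have hx1 : 1 / 2 < x := hs0.trans_le hx.1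
          have hx2 : x ≤ 1 / 2 + 2 * ε := hx.2.trans hs
          rw [ofReal_bidDensity]
          refine le_add_right ?_
          rw [Set.indicator_of_mem (show x ∈ Set.Ioc _ _ from ⟨hx1, hx2⟩)]
          exact ENNReal.ofReal_le_ofReal
            (Real.rpow_le_rpow_of_nonpos (by linarith) (by linarith) (by linarith))
  refine le_trans (Eq.le ?_) (mul_le_mul' hZ hd)
  rw [← ENNReal.ofReal_mul (by positivity)]
  congr 1
  have : (2 * ε) ^ α = (2 * ε) ^ (α - 1) * (2 * ε) := by
    rw [← Real.rpow_add_one (by positivity), sub_add_cancel]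
  rw [this]
  ring

end VickreyBandit

/-! ### Regret lower bounds and margin condition -/

open VickreyBandit in
theorem mainTheorem3 (α : ℝ) (hα : 0 < α) :
    -- the lower bound for `ε = T^(-1/2) / 2`
    (∃ c : ℝ, 0 < c ∧ ∀ T : ℕ, 4 ≤ T →
      ∀ (Θ : Type*) [MeasurableSpace Θ] (S : VickreyBandit.Strategy Θ),
        (if α < 1 then c * (T : ℝ) ^ ((1 - α) / 2) else c * Real.log T) ≤
          VickreyBandit.worstRegret S α (1 / 2 * (T : ℝ) ^ (-(1 / 2) : ℝ)) T) ∧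
    -- for `α ≥ 1` also for every `ε` that does not depend on `T`
    (1 ≤ α → ∀ ε : ℝ, 0 < ε → ε < 1 / 4 → ∃ c : ℝ, 0 < c ∧ ∀ T : ℕ, 2 ≤ T →
      ∀ (Θ : Type*) [MeasurableSpace Θ] (S : VickreyBandit.Strategy Θ),
        c * Real.log T ≤ VickreyBandit.worstRegret S α ε T) ∧
    -- the competing bids satisfy the margin condition, around the mean value of either instance;
    -- for `α < 1` the constant depends on `α` only
    (α < 1 → ∃ C : ℝ, 0 < C ∧ ∀ ε : ℝ, 0 < ε → ε ≤ 1 / 4 →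
      VickreyBandit.MarginCondition (VickreyBandit.bidLaw α ε) α C (1 / 2) ∧
      VickreyBandit.MarginCondition (VickreyBandit.bidLaw α ε) α C (1 / 2 + 2 * ε)) ∧
    (1 ≤ α → ∀ ε : ℝ, 0 < ε → ε ≤ 1 / 4 → ∃ C : ℝ, 0 < C ∧
      VickreyBandit.MarginCondition (VickreyBandit.bidLaw α ε) α C (1 / 2) ∧
      VickreyBandit.MarginCondition (VickreyBandit.bidLaw α ε) α C (1 / 2 + 2 * ε)) := by
  refine ⟨?_, fun h1 ε hε0 hε => exists_mul_log_le_worstRegret h1 hε0 hε, fun h1 => ?_,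
    fun h1 ε hε0 hε => ?_⟩
  · refine ⟨3 / 256 * Real.exp (-4) * min α 1, by positivity, fun T hT Θ _ S => ?_⟩
    have hT4 : (4 : ℝ) ≤ T := by exact_mod_cast hT
    have hT0 : (0 : ℝ) < T := by linarith
    have hsq : ((T : ℝ) ^ (-(1 / 2) : ℝ)) ^ 2 * T = 1 := by
      rw [← Real.rpow_mul_natCast hT0.le, ← Real.rpow_add_one hT0.ne']
      norm_num
    have hmul : T * (T : ℝ) ^ (-(1 / 2) : ℝ) = (T : ℝ) ^ (1 / 2 : ℝ) := by
      rw [mul_comm, ← Real.rpow_add_one hT0.ne']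
      norm_num
    have hpos : 0 < (T : ℝ) ^ (-(1 / 2) : ℝ) := Real.rpow_pos_of_pos hT0 _
    set ε : ℝ := 1 / 2 * (T : ℝ) ^ (-(1 / 2) : ℝ) with hεdef
    have hε0 : 0 < ε := by positivity
    have hε : ε ≤ 1 / 4 := by nlinarith
    have hεT : 4 * (ε ^ 2 * T) ≤ 1 := by rw [hεdef]; nlinarith
    split_ifs with h1
    · have := isProbabilityMeasure_bidLaw hα h1 hε0.le hε
      have hδ := mul_rpow_le_bidLaw_Icc hα h1 hε0.le hε (s := 1 / 2 + ε / 2)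
        (by linarith) (by linarith)
      have hδ' := mul_rpow_le_bidLaw_Icc hα h1 hε0.le hε (s := 1 / 2 + ε)
        (by linarith) (by linarith)
      rw [show 1 / 2 + ε / 2 + ε / 2 = 1 / 2 + ε by ring] at hδ
      rw [show 1 / 2 + ε + ε / 2 = 1 / 2 + 3 * ε / 2 by ring] at hδ'
      refine le_trans (Eq.le ?_) (mul_le_worstRegret S (bidLaw_mem_Icc hα h1 hε0.le hε) hε0 hε
        (by positivity) hδ hδ' hεT)
      have h2 : (T : ℝ) ^ ((1 - α) / 2) = T * (T : ℝ) ^ (-(1 / 2) : ℝ) * (2 * ε) ^ α := by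
        rw [hmul, hεdef, ← mul_assoc, show (2 : ℝ) * (1 / 2) = 1 by norm_num, one_mul,
          ← Real.rpow_mul hT0.le, ← Real.rpow_add hT0]
        congr 1
        ring
      rw [h2, min_eq_left h1.le]
      nth_rw 3 [hεdef]
      ring
    · have hlaw : bidLaw α ε = Measure.dirac (1 / 2 + ε) := by rw [bidLaw, if_neg h1]
      have hprob : IsProbabilityMeasure (bidLaw α ε) := by rw [hlaw]; infer_instance
      have hμ : ∀ᵐ x ∂(bidLaw α ε), x ∈ Set.Icc (0 : ℝ) 1 := by
        rw [hlaw]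
        exact (ae_dirac_iff measurableSet_Icc).2 ⟨by linarith, by linarith⟩
      have h2 := mul_le_worstRegret S hμ hε0 hε (δ := 1) zero_le_one
        (by rw [hlaw, measureReal_def, Measure.dirac_apply_of_mem (by constructor <;> linarith)]
            simp)
        (by rw [hlaw, measureReal_def, Measure.dirac_apply_of_mem (by constructor <;> linarith)]
            simp) hεT
      refine le_trans ?_ h2
      have hlog : Real.log T ≤ 2 * (T : ℝ) ^ (1 / 2 : ℝ) := by
        have := Real.log_le_rpow_div (x := T) hT0.le (ε := 1 / 2) (by norm_num)
        linarith
      have h3 : T * ε * 1 = (T : ℝ) ^ (1 / 2 : ℝ) / 2 := by rw [hεdef, ← hmul]; ring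
      have h4 : 0 ≤ (T : ℝ) ^ (1 / 2 : ℝ) := by positivity
      rw [min_eq_right (not_lt.1 h1), h3]
      calc 3 / 256 * Real.exp (-4) * 1 * Real.log T
          ≤ 3 / 256 * Real.exp (-4) * 1 * (2 * (T : ℝ) ^ (1 / 2 : ℝ)) := by gcongr
        _ ≤ 3 / 16 * Real.exp (-4) * ((T : ℝ) ^ (1 / 2 : ℝ) / 2) := by
            nlinarith [mul_nonneg (Real.exp_pos (-4)).le h4]
  · refine ⟨4 / α, by positivity, fun ε hε0 hε => ?_⟩
    exact ⟨⟨isProbabilityMeasure_bidLaw hα h1 hε0.le hε, bidLaw_mem_Icc hα h1 hε0.le hε,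
      fun u hu => bidLaw_Ioc_le hα h1 hε0.le hu.le (Or.inl rfl)⟩,
      ⟨isProbabilityMeasure_bidLaw hα h1 hε0.le hε, bidLaw_mem_Icc hα h1 hε0.le hε,
      fun u hu => bidLaw_Ioc_le hα h1 hε0.le hu.le (Or.inr rfl)⟩⟩
  · have hlaw : bidLaw α ε = Measure.dirac (1 / 2 + ε) := by rw [bidLaw, if_neg h1.not_gt]
    have hprob : IsProbabilityMeasure (bidLaw α ε) := by rw [hlaw]; infer_instance
    have hμ : ∀ᵐ x ∂(bidLaw α ε), x ∈ Set.Icc (0 : ℝ) 1 := by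
      rw [hlaw]
      exact (ae_dirac_iff measurableSet_Icc).2 ⟨by linarith, by linarith⟩
    refine ⟨ε ^ (-α), by positivity, ⟨hprob, hμ, fun u hu => ?_⟩, ⟨hprob, hμ, fun u hu => ?_⟩⟩
    -- An interval `(1/2, 1/2 + u]` charged by the point mass has `u ≥ ε`.
    · rcases le_or_gt ε u with h | h
      · refine prob_le_one.trans (ENNReal.one_le_ofReal.2 ?_)
        rw [Real.rpow_neg hε0.le, ← Real.inv_rpow hε0.le, ← Real.mul_rpow (by positivity) hu.le]
        refine Real.one_le_rpow ?_ hα.le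
        rw [inv_mul_eq_div, one_le_div hε0]
        exact h
      · rw [hlaw, Measure.dirac_apply' _ measurableSet_Ioc,
          Set.indicator_of_notMem fun hm => by linarith [hm.2]]
        exact zero_le
    · rw [hlaw, Measure.dirac_apply' _ measurableSet_Ioc,
        Set.indicator_of_notMem fun hm => by linarith [hm.1]]
      exact zero_le
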